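/- Let $N$ be a diffuse von Neumann algebra acting on a separable Hilbert space, with a faithful normal tracial state $\tau$, and let $\alpha=(\alpha_n)_{n\in\mathbb{Z}}$ be an action of $\mathbb{Z}$ on $N$ by $\tau$-preserving $*$-automorphisms which is - *free*: for $n\neq 0$, if $a\in N$ satisfies $ax=\alpha_n(x)a$ for all $x\in N$, then $a=0$; - *mixing*: $\tau(x\,\alpha_n(y))\to\tau(x)\tau(y)$ as $|n|\to\infty$, for all $x,y\in N$. Let $M=N\rtimes_\alpha\mathbb{Z}$, with the trace induced by $\tau$ and the canonical unitaries $u_n$, $n\in\mathbb{Z}$, implementing $\alpha$. Let $\lambda$ be the normalized Haar measure on the circle $S^1$, and identify $L(\mathbb{Z})=\{u_n\}''\subset M$ with $L^\infty(S^1,\lambda)$ by sending $u_n$ to the function $t\mapsto t^n$. Let $\eta$ be a finite measure representing the left–right measure of $L(\mathbb{Z})\subset M$. That is, there is a finite Borel measure $\rho$ on $S^1\times S^1$ and a unitary from $L^2(M)$ onto a direct integral $\int^{\oplus}_{S^1\times S^1}\mathcal{H}_{t,s}\,d\rho(t,s)$ of separable Hilbert spaces that are non-zero for $\rho$-almost every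 $(t,s)$, under which $\zeta\mapsto u_m\zeta u_n$ becomes multiplication by $(t,s)\mapsto t^m s^n$ for all $m,n\in\mathbb{Z}$; and $\eta$ is a finite Borel measure having the same null sets as the restriction of $\rho$ to the complement of the diagonal of $S^1\times S^1$. Then $\eta$ has a disintegration $\{\eta^t\}_{t\in S^1}$ with respect to the first coordinate projection $\pi_1$ and $\lambda$, that is, a family of $\sigma$-finite Borel measures on $S^1\times S^1$ such that $\eta^t$ is concentrated on $\{t\}\times S^1$ for $\lambda$-almost every $t$ and, for every Borel function $f\geq 0$ on $S^1\times S^1$, the function $t\mapsto\int f\,d\eta^t$ is Borel and $\int f\,d\eta=\int_{S^1}\left(\int f\,d\eta^t\right)d\lambda(t)$. Moreover, for every such disintegration, for $\lambda$-almost every $t\in S^1$ the measure $\tilde\eta^t$ on $S^1$, obtained by restricting $\eta^t$ to $\{t\}\times S^1\cong S^1$, is a mixing (Rajchman) measure: it is finite and $\int_{S^1}s^n\,d\tilde\eta^t(s)\to 0$ as $|n|\to\infty$. -/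

import Mathlib

open MeasureTheory Filter Topology
open scoped ENNReal InnerProductSpace ComplexOrder

noncomputable section

namespace CrossedMixing

universe u

/-! ### Von Neumann algebras: generation, positive functionals, traces, the standard space -/

section VonNeumann

variable {H : Type u} [NormedAddCommGroup H] [InnerProductSpace ℂ H] [CompleteSpace H]

/-- The underlying ⋆-algebra of a von Neumann algebra, as a type. -/
abbrev Elem (M : VonNeumannAlgebra H) : Type u := M.toStarSubalgebra

/-- The von Neumann algebra generated by a set of bounded operators: the double commutant of the
set together with its adjoints. -/
def vnGenerate (S : Set (H →L[ℂ] H)) : VonNeumannAlgebra H where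
  toStarSubalgebra :=
    StarSubalgebra.centralizer ℂ (StarSubalgebra.centralizer ℂ S : Set (H →L[ℂ] H))
  centralizer_centralizer' := by
    change Set.centralizer (Set.centralizer
      ((StarSubalgebra.centralizer ℂ
        (StarSubalgebra.centralizer ℂ S : Set (H →L[ℂ] H)) : StarSubalgebra ℂ (H →L[ℂ] H)) :
          Set (H →L[ℂ] H))) = _
    rw [StarSubalgebra.coe_centralizer_centralizer, Set.centralizer_centralizer_centralizer]
    exact (StarSubalgebra.coe_centralizer_centralizer ℂ S).symm

theorem coe_vnGenerate (S : Set (H →L[ℂ] H)) :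
    ((vnGenerate S).toStarSubalgebra : Set (H →L[ℂ] H)) =
      Set.centralizer (Set.centralizer (S ∪ star S)) :=
  StarSubalgebra.coe_centralizer_centralizer ℂ S

theorem subset_vnGenerate (S : Set (H →L[ℂ] H)) :
    S ⊆ ((vnGenerate S).toStarSubalgebra : Set (H →L[ℂ] H)) := by
  rw [coe_vnGenerate]
  exact Set.subset_union_left.trans Set.subset_centralizer_centralizer

theorem isClosed_elem (M : VonNeumannAlgebra H) :
    IsClosed (M.toStarSubalgebra : Set (H →L[ℂ] H)) := by
  rw [VonNeumannAlgebra.coe_toStarSubalgebra, ← M.centralizer_centralizer]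
  exact Set.isClosed_centralizer _

theorem norm_starAlgEquiv (M : VonNeumannAlgebra H) (f : Elem M ≃⋆ₐ[ℂ] Elem M) (x : Elem M) :
    ‖(f x : H →L[ℂ] H)‖ = ‖(x : H →L[ℂ] H)‖ := by
  have : IsClosed (M.toStarSubalgebra : Set (H →L[ℂ] H)) := isClosed_elem M
  exact StarAlgEquiv.norm_map f x

/-- `M` is diffuse: it has no minimal projections. -/
def IsDiffuse (M : VonNeumannAlgebra H) : Prop :=
  ∀ p ∈ M, IsStarProjection p → p ≠ 0 →
    ∃ q ∈ M, IsStarProjection q ∧ q ≠ 0 ∧ q ≠ p ∧ p * q = q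

/-- A positive linear functional on a von Neumann algebra. -/
structure PositiveFunctional (M : VonNeumannAlgebra H) where
  toLin : Elem M →ₗ[ℂ] ℂ
  nonneg : ∀ x : Elem M, (x : H →L[ℂ] H).IsPositive → 0 ≤ toLin x

namespace PositiveFunctional

instance (M : VonNeumannAlgebra H) : CoeFun (PositiveFunctional M) (fun _ => Elem M → ℂ) :=
  ⟨fun φ => φ.toLin⟩

variable {M : VonNeumannAlgebra H} (φ : PositiveFunctional M)

theorem nonneg_star_mul (x : Elem M) : 0 ≤ φ (star x * x) :=
  φ.nonneg _ (ContinuousLinearMap.isPositive_adjoint_comp_self (x : H →L[ℂ] H))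

theorem map_star (x : Elem M) : φ (star x) = star (φ x) := by
  have key : ∀ z : ℂ, (φ (star (x + z • (1 : Elem M)) * (x + z • (1 : Elem M)))).im = 0 :=
    fun z => (Complex.nonneg_iff.1 (φ.nonneg_star_mul _)).2.symm
  have e : ∀ z : ℂ, φ (star (x + z • (1 : Elem M)) * (x + z • (1 : Elem M))) =
      φ (star x * x) + z * φ (star x) + (star z * φ x + star z * z * φ 1) := by
    intro z
    have : star (x + z • (1 : Elem M)) * (x + z • (1 : Elem M)) =
        star x * x + z • star x + (star z • x + (star z * z) • (1 : Elem M)) := by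
      simp only [star_add, star_smul, star_one, add_mul, mul_add, smul_mul_assoc, mul_smul_comm,
        mul_one, one_mul, smul_add, smul_smul]
      rw [mul_comm z (star z)]
      abel
    rw [this]
    simp only [_root_.map_add, _root_.map_smul, smul_eq_mul]
  have h0 := key 0
  have h1 := key 1
  have h2 := key Complex.I
  have h3 := key (-1)
  have h4 := key (-Complex.I)
  rw [e] at h0 h1 h2 h3 h4
  simp at h0 h1 h2 h3 h4
  apply Complex.ext
  · simp; linarith
  · simp; linarith

/-- A copy of `M`, carrying the semi-inner product `⟪x, y⟫ = φ (x⋆ y)` (linear in the second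
variable). -/
def PreL2 (_φ : PositiveFunctional M) : Type u := Elem M

instance : AddCommGroup φ.PreL2 := inferInstanceAs (AddCommGroup (Elem M))
instance : Module ℂ φ.PreL2 := inferInstanceAs (Module ℂ (Elem M))

/-- The identity map from `M` to its copy. -/
def toPreL2 : Elem M ≃ₗ[ℂ] φ.PreL2 := LinearEquiv.refl ℂ _

/-- The semi-inner product given by `φ`. -/
abbrev preL2Core : PreInnerProductSpace.Core ℂ φ.PreL2 where
  inner x y := φ (star (φ.toPreL2.symm x) * φ.toPreL2.symm y)
  conj_inner_symm x y := by
    change star _ = _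
    rw [← φ.map_star]; simp
  re_inner_nonneg x := (Complex.nonneg_iff.1 (φ.nonneg_star_mul _)).1
  add_left x y z := by
    rw [_root_.map_add, star_add, add_mul, _root_.map_add]
  smul_left x y r := by
    rw [_root_.map_smul, star_smul, smul_mul_assoc, _root_.map_smul]; rfl

instance : SeminormedAddCommGroup φ.PreL2 :=
  InnerProductSpace.Core.toSeminormedAddCommGroup (c := φ.preL2Core)
instance : InnerProductSpace ℂ φ.PreL2 :=
  InnerProductSpace.ofCore φ.preL2Core

/-- The Hilbert space `L²(M, φ)`: the completion of `M` in the norm `‖x‖₂ = φ (x⋆ x) ^ (1/2)`. -/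
abbrev L2 : Type u := UniformSpace.Completion φ.PreL2

/-- The canonical map `M → L²(M, φ)`. -/
def toL2 (x : Elem M) : φ.L2 := ((φ.toPreL2 x : φ.PreL2) : UniformSpace.Completion φ.PreL2)

theorem inner_toL2 (x y : Elem M) : ⟪φ.toL2 x, φ.toL2 y⟫_ℂ = φ (star x * y) :=
  UniformSpace.Completion.inner_coe _ _

/-- `φ` is a faithful normal tracial state.  Normality is continuity in the ultraweak
(`σ`-weak) topology: `φ` has the form `x ↦ ∑ ⟪ηₙ, x ξₙ⟫` with `∑ ‖ξₙ‖² < ∞`, `∑ ‖ηₙ‖² < ∞`. -/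
structure IsFaithfulNormalTracialState : Prop where
  map_one : φ 1 = 1
  tracial : ∀ x y, φ (x * y) = φ (y * x)
  faithful : ∀ x, φ (star x * x) = 0 → x = 0
  normal : ∃ ξ η : ℕ → H, (Summable fun n => ‖ξ n‖ ^ 2) ∧ (Summable fun n => ‖η n‖ ^ 2) ∧
    ∀ x : Elem M, HasSum (fun n => ⟪η n, (x : H →L[ℂ] H) (ξ n)⟫_ℂ) (φ x)

end PositiveFunctional

end VonNeumann

/-! ### Actions of `ℤ` -/

section Action

variable {H : Type u} [NormedAddCommGroup H] [InnerProductSpace ℂ H] [CompleteSpace H]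

/-- An action of `ℤ` on a von Neumann algebra by `⋆`-automorphisms. -/
abbrev IntAction (N : VonNeumannAlgebra H) : Type u :=
  Multiplicative ℤ →* (Elem N ≃⋆ₐ[ℂ] Elem N)

variable {N : VonNeumannAlgebra H}

/-- The automorphism `αₙ` of the action `α`. -/
def IntAction.at (α : IntAction N) (n : ℤ) : Elem N ≃⋆ₐ[ℂ] Elem N :=
  α (Multiplicative.ofAdd n)

/-- The action preserves `τ`. -/
def IntAction.Preserves (α : IntAction N) (τ : PositiveFunctional N) : Prop :=
  ∀ (n : ℤ) (x : Elem N), τ (α.at n x) = τ x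

/-- The action is free (properly outer): for `n ≠ 0`, only `a = 0` satisfies
`a x = αₙ(x) a` for all `x`. -/
def IntAction.IsFree (α : IntAction N) : Prop :=
  ∀ n : ℤ, n ≠ 0 → ∀ a : Elem N, (∀ x : Elem N, a * x = α.at n x * a) → a = 0

/-- The action is mixing with respect to `τ`: `τ(x αₙ(y)) → τ(x) τ(y)` as `|n| → ∞`. -/
def IntAction.IsMixing (α : IntAction N) (τ : PositiveFunctional N) : Prop :=
  ∀ x y : Elem N, Tendsto (fun n : ℤ => τ (x * α.at n y)) cofinite (𝓝 (τ x * τ y))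

/-! ### The crossed product `N ⋊ ℤ` -/

variable (H) in
/-- The Hilbert space `ℓ²(ℤ, H) = H ⊗ ℓ²(ℤ)`. -/
abbrev EllTwo : Type u := lp (fun _ : ℤ => H) 2

/-- The representation `π` of `N` on `ℓ²(ℤ, H)`: `(π(x) ξ)(n) = α₋ₙ(x) (ξ n)`. -/
def piRep (α : IntAction N) (x : Elem N) : EllTwo H →L[ℂ] EllTwo H :=
  lp.mapCLM 2 (fun n : ℤ => ((α.at (-n) x : Elem N) : H →L[ℂ] H))
    (K := ‖(x : H →L[ℂ] H)‖) (norm_nonneg _)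
    (fun n => (norm_starAlgEquiv N (α.at (-n)) x).le)

theorem piRep_apply (α : IntAction N) (x : Elem N) (ξ : EllTwo H) (n : ℤ) :
    piRep α x ξ n = ((α.at (-n) x : Elem N) : H →L[ℂ] H) (ξ n) := rfl

theorem memlp_shift (m : ℤ) (ξ : EllTwo H) :
    Memℓp (fun n : ℤ => (ξ : ∀ _ : ℤ, H) (n - m)) 2 := by
  apply memℓp_gen
  have h := (lp.memℓp ξ).summable (by norm_num)
  exact (Equiv.subRight m).summable_iff.2 h

variable (H) in
/-- The translation `λₘ` on `ℓ²(ℤ, H)`: `(λₘ ξ)(n) = ξ(n - m)`. -/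
def shiftOp (m : ℤ) : EllTwo H →L[ℂ] EllTwo H :=
  LinearMap.mkContinuous
    { toFun := fun ξ => ⟨fun n : ℤ => (ξ : ∀ _ : ℤ, H) (n - m), memlp_shift m ξ⟩
      map_add' := fun _ _ => rfl
      map_smul' := fun _ _ => rfl } 1 (by
    intro ξ
    rw [one_mul, lp.norm_eq_tsum_rpow (by norm_num), lp.norm_eq_tsum_rpow (by norm_num)]
    apply le_of_eq
    congr 1
    exact (Equiv.subRight m).tsum_eq (fun n : ℤ => ‖(ξ : ∀ _ : ℤ, H) n‖ ^ (2 : ℝ≥0∞).toReal))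

theorem shiftOp_apply (m : ℤ) (ξ : EllTwo H) (n : ℤ) : shiftOp H m ξ n = ξ (n - m) := rfl

theorem shiftOp_mul (m n : ℤ) : shiftOp H m * shiftOp H n = shiftOp H (m + n) := by
  ext ξ k
  exact congrArg (ξ : ∀ _ : ℤ, H) (show k - m - n = k - (m + n) by ring)

theorem shiftOp_zero : shiftOp H 0 = 1 := by
  ext ξ k
  exact congrArg (ξ : ∀ _ : ℤ, H) (sub_zero k)

theorem star_shiftOp (m : ℤ) : star (shiftOp H m) = shiftOp H (-m) := by
  rw [ContinuousLinearMap.star_eq_adjoint]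
  symm
  rw [ContinuousLinearMap.eq_adjoint_iff]
  intro ξ ζ
  rw [lp.inner_eq_tsum, lp.inner_eq_tsum,
    ← (Equiv.subRight m).tsum_eq (fun n : ℤ => ⟪(shiftOp H (-m) ξ) n, ζ n⟫_ℂ)]
  refine tsum_congr fun n => ?_
  simp only [Equiv.subRight_apply, shiftOp_apply]
  rw [show n - m - -m = n by ring]

/-- The generators `π(x)`, `x ∈ N`, and `λₘ`, `m ∈ ℤ`, of the crossed product. -/
def crossedGen (α : IntAction N) : Set (EllTwo H →L[ℂ] EllTwo H) :=
  Set.range (piRep α) ∪ Set.range (shiftOp H)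

/-- The crossed product von Neumann algebra `N ⋊_α ℤ` on `ℓ²(ℤ, H)`. -/
def crossedProduct (α : IntAction N) : VonNeumannAlgebra (EllTwo H) :=
  vnGenerate (crossedGen α)

/-- The canonical unitary `u = λ₁` of the crossed product; `uⁿ = λₙ`, and `u` generates the
von Neumann subalgebra `L(ℤ)`. -/
def canonicalUnitary (α : IntAction N) : unitary (Elem (crossedProduct α)) :=
  ⟨⟨shiftOp H 1, subset_vnGenerate _ (Or.inr ⟨1, rfl⟩)⟩, by
    rw [Unitary.mem_iff]
    constructor <;> apply Subtype.ext
    · change star (shiftOp H 1) * shiftOp H 1 = 1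
      rw [star_shiftOp, shiftOp_mul, neg_add_cancel, shiftOp_zero]
    · change shiftOp H 1 * star (shiftOp H 1) = 1
      rw [star_shiftOp, shiftOp_mul, add_neg_cancel, shiftOp_zero]⟩

variable (H) in
/-- The embedding of `H` into `ℓ²(ℤ, H)` as the coordinate at `0`. -/
def deltaZero : H →L[ℂ] EllTwo H := lp.singleContinuousLinearMap ℂ (fun _ : ℤ => H) 2 0

theorem adjoint_deltaZero (ξ : EllTwo H) : (deltaZero H).adjoint ξ = ξ 0 := by
  refine ext_inner_left ℂ fun v => ?_
  rw [ContinuousLinearMap.adjoint_inner_right]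
  exact lp.inner_single_left (𝕜 := ℂ) (G := fun _ : ℤ => H) (0 : ℤ) v ξ

variable (H) in
/-- The `(0, 0)` matrix entry of an operator on `ℓ²(ℤ, H)`. -/
def entryZero (T : EllTwo H →L[ℂ] EllTwo H) : H →L[ℂ] H :=
  (deltaZero H).adjoint ∘L T ∘L deltaZero H

/-- The diagonal operator `c ⊗ 1` on `ℓ²(ℤ, H)`. -/
def constOp (c : H →L[ℂ] H) : EllTwo H →L[ℂ] EllTwo H :=
  lp.mapCLM 2 (fun _ : ℤ => c) (K := ‖c‖) (norm_nonneg _) (fun _ => le_rfl)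

theorem constOp_apply (c : H →L[ℂ] H) (ξ : EllTwo H) (n : ℤ) : constOp c ξ n = c (ξ n) := rfl

theorem star_constOp (c : H →L[ℂ] H) : star (constOp c) = constOp (star c) := by
  rw [ContinuousLinearMap.star_eq_adjoint]
  symm
  rw [ContinuousLinearMap.eq_adjoint_iff]
  intro ξ ζ
  rw [lp.inner_eq_tsum, lp.inner_eq_tsum]
  refine tsum_congr fun n => ?_
  rw [constOp_apply, constOp_apply, ContinuousLinearMap.star_eq_adjoint,
    ContinuousLinearMap.adjoint_inner_left]

theorem constOp_comm_gen (α : IntAction N) {c : H →L[ℂ] H}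
    (hc : c ∈ Set.centralizer (N : Set (H →L[ℂ] H))) {T : EllTwo H →L[ℂ] EllTwo H}
    (hT : T ∈ crossedGen α) : T * constOp c = constOp c * T := by
  rcases hT with ⟨x, rfl⟩ | ⟨m, rfl⟩
  · ext ξ n
    exact congrArg (fun S : H →L[ℂ] H => S (ξ n)) (hc _ (α.at (-n) x).2)
  · rfl

theorem constOp_mem_centralizer (α : IntAction N) {c : H →L[ℂ] H}
    (hc : c ∈ Set.centralizer (N : Set (H →L[ℂ] H))) :
    constOp c ∈ Set.centralizer (crossedGen α ∪ star (crossedGen α)) := by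
  have hc' : star c ∈ Set.centralizer (N : Set (H →L[ℂ] H)) := by
    intro y hy
    have := congrArg star (hc (star y) (star_mem (S := VonNeumannAlgebra H) hy))
    simpa using this.symm
  rintro T (hT | hT)
  · exact constOp_comm_gen α hc hT
  · have h := congrArg star (constOp_comm_gen α hc' hT)
    rw [star_mul, star_mul, star_star, star_constOp, star_star] at h
    exact h.symm

/-- The `(0, 0)` entry of an element of the crossed product lies in `N`. -/
theorem entryZero_mem (α : IntAction N) (T : Elem (crossedProduct α)) :
    entryZero H (T : EllTwo H →L[ℂ] EllTwo H) ∈ N.toStarSubalgebra := by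
  have hT : (T : EllTwo H →L[ℂ] EllTwo H) ∈
      Set.centralizer (Set.centralizer (crossedGen α ∪ star (crossedGen α))) := by
    rw [← coe_vnGenerate]; exact T.2
  change _ ∈ (N : Set (H →L[ℂ] H))
  rw [← N.centralizer_centralizer]
  intro c hc
  have h := hT _ (constOp_mem_centralizer α hc)
  have h1 : ∀ v, constOp c (deltaZero H v) = deltaZero H (c v) := by
    intro v
    ext n
    rw [constOp_apply]
    change c ((lp.single 2 (0 : ℤ) v : EllTwo H) n) = (lp.single 2 (0 : ℤ) (c v) : EllTwo H) n
    rw [lp.single_apply, lp.single_apply]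
    by_cases hn : n = 0
    · subst hn; simp
    · simp [hn]
  ext v
  have h2 := congrArg (fun S : EllTwo H →L[ℂ] EllTwo H => (S (deltaZero H v)) 0) h
  have h3 : c ((deltaZero H).adjoint ((T : EllTwo H →L[ℂ] EllTwo H) (deltaZero H v))) =
      (deltaZero H).adjoint ((T : EllTwo H →L[ℂ] EllTwo H) (deltaZero H (c v))) := by
    rw [adjoint_deltaZero, adjoint_deltaZero, ← h1]
    exact h2
  exact h3

/-- The normal conditional expectation of `N ⋊ ℤ` onto `N`, as an `N`-valued linear map. -/
def condExpN (α : IntAction N) : Elem (crossedProduct α) →ₗ[ℂ] Elem N where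
  toFun T := ⟨entryZero H (T : EllTwo H →L[ℂ] EllTwo H), entryZero_mem α T⟩
  map_add' S T := by
    apply Subtype.ext
    ext v
    simp [entryZero]
  map_smul' c T := by
    apply Subtype.ext
    ext v
    simp [entryZero]

/-- The functional on `N ⋊ ℤ` induced by `τ`, namely `τ ∘ E_N`; on the generators it is
`π(x) λₙ ↦ τ(x)` for `n = 0` and `0` for `n ≠ 0`. -/
def crossedTrace (τ : PositiveFunctional N) (α : IntAction N) :
    PositiveFunctional (crossedProduct α) where
  toLin := τ.toLin ∘ₗ condExpN α
  nonneg _ hT := τ.nonneg _ (hT.adjoint_conj (deltaZero H))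

end Action

/-! ### Direct integrals of Hilbert spaces -/

section DirectIntegral

/-- A measurable field of separable Hilbert spaces over `Z`, given by a fundamental sequence of
sections.  (Every separable Hilbert space has an isomorphic copy in `Type`.) -/
structure MeasurableHilbertField (Z : Type*) [MeasurableSpace Z] where
  fiber : Z → Type
  [normed : ∀ z, NormedAddCommGroup (fiber z)]
  [innerProd : ∀ z, InnerProductSpace ℂ (fiber z)]
  [complete : ∀ z, CompleteSpace (fiber z)]
  /-- the fundamental sequence -/
  fund : ℕ → ∀ z, fiber z
  measurable_inner : ∀ i j, Measurable fun z => ⟪fund i z, fund j z⟫_ℂ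
  total : ∀ z, (Submodule.span ℂ (Set.range fun i => fund i z)).topologicalClosure = ⊤

attribute [instance] MeasurableHilbertField.normed MeasurableHilbertField.innerProd
  MeasurableHilbertField.complete

variable {Z : Type*} [MeasurableSpace Z]

/-- Square-integrable measurable sections of a field: the vectors (before identifying sections
which agree almost everywhere) of the direct integral `∫^⊕ fiber z dρ(z)`. -/
structure MeasurableHilbertField.IsL2Section (F : MeasurableHilbertField Z) (ρ : Measure Z)
    (f : ∀ z, F.fiber z) : Prop where
  measurable : ∀ i, AEMeasurable (fun z => ⟪F.fund i z, f z⟫_ℂ) ρ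
  integrable : Integrable (fun z => ‖f z‖ ^ 2) ρ

/-- A unitary operator from the Hilbert space `K` onto the direct integral `∫^⊕ fiber z dρ(z)`,
in terms of representatives: `toSection ζ` is a section representing the image of `ζ`. -/
structure DirectIntegralIso (F : MeasurableHilbertField Z) (ρ : Measure Z)
    (K : Type*) [NormedAddCommGroup K] [InnerProductSpace ℂ K] where
  toSection : K → ∀ z, F.fiber z
  isL2Section : ∀ ζ, F.IsL2Section ρ (toSection ζ)
  map_add : ∀ ζ ζ', ∀ᵐ z ∂ρ, toSection (ζ + ζ') z = toSection ζ z + toSection ζ' z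
  map_smul : ∀ (c : ℂ) ζ, ∀ᵐ z ∂ρ, toSection (c • ζ) z = c • toSection ζ z
  norm_sq : ∀ ζ, ‖ζ‖ ^ 2 = ∫ z, ‖toSection ζ z‖ ^ 2 ∂ρ
  surjective : ∀ f, F.IsL2Section ρ f → ∃ ζ, ∀ᵐ z ∂ρ, toSection ζ z = f z

end DirectIntegral

/-! ### The left–right measure -/

section LeftRight

variable {K : Type u} [NormedAddCommGroup K] [InnerProductSpace ℂ K] [CompleteSpace K]

/-- Let `M` be a von Neumann algebra with trace `φ`, and `v ∈ M` a Haar unitary generating the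
abelian subalgebra `A = {v}''`; identify `A` with `L^∞(S¹)` so that `v` is the coordinate
function, where `S¹ = ℝ/ℤ` and the coordinate function is `t ↦ e^{2πit} = fourier 1 t`.

The finite measure `μ` on `S¹ × S¹` is a *left–right measure* of `A` (a representative of the
class `[η|_{Δᶜ}]`) if it is equivalent to the restriction to the complement of the diagonal of a
finite measure `ρ` over which `L²(M)` is a direct integral with non-zero fibres, in such a way that
`vᵐ ζ vⁿ` corresponds to multiplication by `(t, s) ↦ tᵐ sⁿ`.  (The functions `tᵐ sⁿ` generate
`L^∞(S¹ × S¹, ρ)`, so that the diagonalizable operators are exactly `(A ∪ JAJ)''`; the vectors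
`ζ ∈ M` are dense in `L²(M)`, so that it is enough to consider these.) -/
def IsLeftRightMeasure {M : VonNeumannAlgebra K} (φ : PositiveFunctional M)
    (v : unitary (Elem M)) (μ : Measure (UnitAddCircle × UnitAddCircle)) : Prop :=
  IsFiniteMeasure μ ∧
  ∃ (ρ : Measure (UnitAddCircle × UnitAddCircle)) (_ : IsFiniteMeasure ρ)
    (F : MeasurableHilbertField (UnitAddCircle × UnitAddCircle))
    (U : DirectIntegralIso F ρ φ.L2),
    (∀ᵐ z ∂ρ, Nontrivial (F.fiber z)) ∧
    (∀ (m n : ℤ) (y : Elem M), ∀ᵐ z ∂ρ,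
      U.toSection (φ.toL2 (((v ^ m : unitary (Elem M)) : Elem M) * y *
          ((v ^ n : unitary (Elem M)) : Elem M))) z =
        ((fourier m z.1 : ℂ) * (fourier n z.2 : ℂ)) • U.toSection (φ.toL2 y) z) ∧
    μ ≪ ρ.restrict (Set.diagonal UnitAddCircle)ᶜ ∧
    ρ.restrict (Set.diagonal UnitAddCircle)ᶜ ≪ μ

end LeftRight

/-! ### Disintegration and mixing measures -/

/-- `κ` is a disintegration of the measure `β` with respect to the map `T` and the measure `μ`. -/
structure IsDisintegration {X Y : Type*} [MeasurableSpace X] [MeasurableSpace Y]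
    (β : Measure X) (T : X → Y) (μ : Measure Y) (κ : Y → Measure X) : Prop where
  sigmaFinite : ∀ y, SigmaFinite (κ y)
  concentrated : ∀ᵐ y ∂μ, κ y {x | T x ≠ y} = 0
  measurable : ∀ f : X → ℝ≥0∞, Measurable f → Measurable fun y => ∫⁻ x, f x ∂(κ y)
  lintegral_eq : ∀ f : X → ℝ≥0∞, Measurable f →
    ∫⁻ x, f x ∂β = ∫⁻ y, ∫⁻ x, f x ∂(κ y) ∂μ

/-- The restriction of a measure on `X × X` to the fibre `{t} × X`, as a measure on `X`. -/
def fiberMeasure {X : Type*} [MeasurableSpace X] (ν : Measure (X × X)) (t : X) : Measure X :=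
  ν.comap (Prod.mk t)

/-- A mixing (Rajchman) measure on the circle: a finite measure whose Fourier coefficients
`∫ sⁿ dν(s)` tend to zero as `|n| → ∞`. -/
def IsMixingMeasure (ν : Measure UnitAddCircle) : Prop :=
  IsFiniteMeasure ν ∧ Tendsto (fun n : ℤ => ∫ s, (fourier n s : ℂ) ∂ν) cofinite (𝓝 0)

end CrossedMixing

end

open CrossedMixing

/-! For `x ∈ N` with `τ x = 0`, the spectral measure of the vector `π(x)` of `L²(M)` under the
left–right action of `L(ℤ)` has Fourier coefficient `τ(x⋆ αₘ(x))` at `(m, -m)` and zero at `(m, n)`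
with `m + n ≠ 0`.  Hence it is the image of `λ × ν` under `(t, r) ↦ (t, t - r)`, where `ν` has
Fourier coefficients `τ(x⋆ αₘ(x))`, so that `ν` is a mixing measure.  The vectors `uᵏ π(x)` together
with `L²(L(ℤ))`, which lives on the diagonal, span `L²(M)`, and countably many of them determine the
null sets of `ρ` off the diagonal; so `η` is absolutely continuous with respect to the image of
`λ × ν` for a single mixing measure `ν`.  The fibres of the latter are reflected translates of `ν`,
and measures absolutely continuous with respect to a mixing measure are mixing.  Disintegrations are
unique up to null sets. -/

noncomputable section

namespace CrossedMixing

section MeasureDetermination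

open scoped BoundedContinuousFunction

variable {𝕜 E : Type*} [RCLike 𝕜] [MeasurableSpace E] [PseudoEMetricSpace E] [BorelSpace E]

theorem integral_eq_of_mem_span {P Q : Measure E} [IsFiniteMeasure P] [IsFiniteMeasure Q]
    {S : Set (E →ᵇ 𝕜)} (h : ∀ f ∈ S, ∫ x, f x ∂P = ∫ x, f x ∂Q) {f : E →ᵇ 𝕜}
    (hf : f ∈ Submodule.span 𝕜 S) : ∫ x, f x ∂P = ∫ x, f x ∂Q := by
  induction hf using Submodule.span_induction with
  | mem f hf => exact h f hf
  | zero => simp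
  | add f g _ _ hf hg =>
    simp only [BoundedContinuousFunction.add_apply]
    rw [integral_add (f.integrable P) (g.integrable P),
      integral_add (f.integrable Q) (g.integrable Q), hf, hg]
  | smul c f _ hf =>
    simp only [BoundedContinuousFunction.smul_apply]
    rw [integral_smul, integral_smul, hf]

theorem ext_of_forall_mem_submonoid_integral_eq [CompleteSpace E] [SecondCountableTopology E]
    {P Q : Measure E} [IsFiniteMeasure P] [IsFiniteMeasure Q] (S : Submonoid (E →ᵇ 𝕜))
    (hstar : ∀ f ∈ S, star f ∈ S) (hsep : ∀ ⦃x y⦄, x ≠ y → ∃ f ∈ S, f x ≠ f y)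
    (h : ∀ f ∈ S, ∫ x, f x ∂P = ∫ x, f x ∂Q) : P = Q := by
  refine ext_of_forall_mem_subalgebra_integral_eq_of_pseudoEMetric_complete_countable
    (A := StarAlgebra.adjoin 𝕜 (S : Set (E →ᵇ 𝕜))) ?_ fun f hf => ?_
  · intro x y hxy
    obtain ⟨f, hf, hfxy⟩ := hsep hxy
    exact ⟨f, ⟨f, ⟨f, StarAlgebra.subset_adjoin 𝕜 _ hf, rfl⟩, rfl⟩, hfxy⟩
  · refine integral_eq_of_mem_span h ?_
    have hS : (S : Set (E →ᵇ 𝕜)) ∪ star (S : Set (E →ᵇ 𝕜)) = S :=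
      Set.union_eq_left.2 fun f hf => star_star f ▸ hstar _ hf
    rwa [← Submonoid.closure_eq S, ← hS, ← StarAlgebra.adjoin_eq_span]

end MeasureDetermination

section Fourier

open scoped BoundedContinuousFunction

local notation "𝕋" => UnitAddCircle
local notation "haar" => (AddCircle.haarAddCircle : Measure UnitAddCircle)

theorem fourier_sub_apply (n : ℤ) (x y : 𝕋) :
    (fourier n (x - y) : ℂ) = fourier n x * fourier (-n) y := by
  simp only [fourier_apply]
  rw [← Circle.coe_mul, ← AddCircle.toCircle_add, smul_sub, neg_smul, sub_eq_add_neg]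

theorem norm_fourier_apply (n : ℤ) (x : 𝕋) : ‖(fourier n x : ℂ)‖ = 1 :=
  Circle.norm_coe _

theorem fourier_one_injective : Function.Injective (fourier 1 : 𝕋 → ℂ) := fun x y h => by
  rw [fourier_one, fourier_one] at h
  exact AddCircle.injective_toCircle one_ne_zero (Circle.coe_injective h)

theorem integral_fourier_haarAddCircle (m : ℤ) :
    ∫ t, (fourier m t : ℂ) ∂haar = if m = 0 then 1 else 0 := by
  have h := congrFun (fourierCoeff_fourier (T := 1) m) 0
  simpa [fourierCoeff, Pi.single_apply, eq_comm] using h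

/-- The characters `(t, s) ↦ tᵐ sⁿ` of the two-dimensional torus, as a homomorphism in `(m, n)`. -/
def torusChar : Multiplicative (ℤ × ℤ) →* (𝕋 × 𝕋 →ᵇ ℂ) where
  toFun p := BoundedContinuousFunction.mkOfCompact
    ⟨fun z => (fourier p.toAdd.1 z.1 : ℂ) * fourier p.toAdd.2 z.2, by fun_prop⟩
  map_one' := by ext z; simp
  map_mul' p q := by ext z; simp; ring

theorem ext_of_integral_fourier_mul_fourier {P Q : Measure (𝕋 × 𝕋)} [IsFiniteMeasure P]
    [IsFiniteMeasure Q]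
    (h : ∀ m n : ℤ, ∫ z, (fourier m z.1 : ℂ) * fourier n z.2 ∂P =
      ∫ z, (fourier m z.1 : ℂ) * fourier n z.2 ∂Q) : P = Q := by
  refine ext_of_forall_mem_submonoid_integral_eq (MonoidHom.mrange torusChar) ?_ ?_ ?_
  · rintro _ ⟨p, rfl⟩
    exact ⟨p⁻¹, by ext z; simp [torusChar]⟩
  · intro z w hzw
    by_contra! hc
    have h1 := hc _ ⟨.ofAdd (1, 0), rfl⟩
    have h2 := hc _ ⟨.ofAdd (0, 1), rfl⟩
    simp only [torusChar, fourier_zero, mul_one, one_mul, MonoidHom.coe_mk, OneHom.coe_mk,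
      BoundedContinuousFunction.mkOfCompact_apply, ContinuousMap.coe_mk, toAdd_ofAdd] at h1 h2
    exact hzw (Prod.ext (fourier_one_injective h1) (fourier_one_injective h2))
  · rintro _ ⟨p, rfl⟩
    exact h p.toAdd.1 p.toAdd.2

end Fourier

section MixingMeasures

local notation "𝕋" => UnitAddCircle

theorem integrable_fourier_mul {ν : Measure 𝕋} {f : 𝕋 → ℂ} (hf : Integrable f ν) (n : ℤ) :
    Integrable (fun s => fourier n s * f s) ν :=
  hf.bdd_mul (map_continuous (fourier n)).aestronglyMeasurable
    (ae_of_all _ fun s => (norm_fourier_apply n s).le)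

theorem norm_integral_fourier_mul_sub_le {ν : Measure 𝕋} {f g : 𝕋 → ℂ} (hf : Integrable f ν)
    (hg : Integrable g ν) (n : ℤ) :
    ‖(∫ s, fourier n s * f s ∂ν) - ∫ s, fourier n s * g s ∂ν‖ ≤ ∫ s, ‖f s - g s‖ ∂ν := by
  rw [← integral_sub (integrable_fourier_mul hf n) (integrable_fourier_mul hg n)]
  refine (norm_integral_le_integral_norm _).trans_eq (integral_congr_ae (ae_of_all _ fun s => ?_))
  change ‖_‖ = ‖_‖
  rw [← mul_sub, norm_mul, norm_fourier_apply, one_mul]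

theorem tendsto_integral_fourier_mul_of_forall_approx {ν : Measure 𝕋} {f : 𝕋 → ℂ}
    (hf : Integrable f ν)
    (happrox : ∀ ε > 0, ∃ g : 𝕋 → ℂ, Integrable g ν ∧ ∫ s, ‖f s - g s‖ ∂ν ≤ ε ∧
      Tendsto (fun n : ℤ => ∫ s, fourier n s * g s ∂ν) cofinite (𝓝 0)) :
    Tendsto (fun n : ℤ => ∫ s, fourier n s * f s ∂ν) cofinite (𝓝 0) := by
  rw [Metric.tendsto_nhds]
  intro ε hε
  obtain ⟨g, hg, hfg, htendsto⟩ := happrox (ε / 2) (half_pos hε)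
  filter_upwards [Metric.tendsto_nhds.1 htendsto (ε / 2) (half_pos hε)] with n hn
  rw [dist_zero_right] at hn ⊢
  have htriangle :=
    norm_sub_norm_le (∫ s, fourier n s * f s ∂ν) (∫ s, fourier n s * g s ∂ν)
  have hdiff := norm_integral_fourier_mul_sub_le hf hg n
  linarith

theorem exists_mem_span_fourier_integral_norm_sub_le (ν : Measure 𝕋)
    [IsFiniteMeasure ν] (f : C(𝕋, ℂ)) {ε : ℝ} (hε : 0 < ε) :
    ∃ p ∈ Submodule.span ℂ (Set.range (@fourier (1 : ℝ))), ∫ s, ‖f s - p s‖ ∂ν ≤ ε := by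
  have hδ : 0 < ε / (ν.real Set.univ + 1) := by positivity
  have hmem : f ∈ (Submodule.span ℂ (Set.range (@fourier (1 : ℝ)))).topologicalClosure := by
    rw [span_fourier_closure_eq_top]; trivial
  obtain ⟨p, hp, hdist⟩ := Metric.mem_closure_iff.1 hmem _ hδ
  have hint : Integrable (fun s => ‖f s - p s‖) ν :=
    ((BoundedContinuousFunction.mkOfCompact (f - p)).integrable ν).norm
  refine ⟨p, hp, ?_⟩
  calc ∫ s, ‖f s - p s‖ ∂ν ≤ ∫ _, ε / (ν.real Set.univ + 1) ∂ν := by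
        refine integral_mono hint (integrable_const _) fun s => ?_
        rw [← dist_eq_norm]
        exact (ContinuousMap.dist_apply_le_dist s).trans hdist.le
    _ = ν.real Set.univ * (ε / (ν.real Set.univ + 1)) := by simp
    _ ≤ ε := by
        rw [mul_div_assoc', div_le_iff₀ (by positivity)]
        nlinarith [measureReal_nonneg (μ := ν) (s := Set.univ)]

namespace IsMixingMeasure

theorem tendsto_integral_fourier_mul_of_mem_span {ν : Measure 𝕋} (hν : IsMixingMeasure ν)
    {f : C(𝕋, ℂ)} (hf : f ∈ Submodule.span ℂ (Set.range (@fourier (1 : ℝ)))) :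
    Tendsto (fun n : ℤ => ∫ s, fourier n s * f s ∂ν) cofinite (𝓝 0) := by
  have := hν.1
  have integrable_cont : ∀ g : C(𝕋, ℂ), Integrable g ν := fun g =>
    (BoundedContinuousFunction.mkOfCompact g).integrable ν
  induction hf using Submodule.span_induction with
  | mem f hf =>
    obtain ⟨m, rfl⟩ := hf
    refine (hν.2.comp (add_left_injective m).tendsto_cofinite).congr fun n => ?_
    simp only [Function.comp_apply, fourier_add]
  | zero => simp
  | add f g _ _ hf hg =>
    have hfg := hf.add hg
    rw [add_zero] at hfg
    refine hfg.congr fun n => ?_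
    rw [← integral_add (integrable_fourier_mul (integrable_cont f) n)
      (integrable_fourier_mul (integrable_cont g) n)]
    simp only [ContinuousMap.add_apply, mul_add]
  | smul c f _ hf =>
    have hcf := hf.const_mul c
    rw [mul_zero] at hcf
    refine hcf.congr fun n => ?_
    rw [← integral_const_mul]
    simp only [ContinuousMap.smul_apply, smul_eq_mul, mul_left_comm]

theorem tendsto_integral_fourier_mul {ν : Measure 𝕋} (hν : IsMixingMeasure ν) {f : 𝕋 → ℂ}
    (hf : Integrable f ν) :
    Tendsto (fun n : ℤ => ∫ s, fourier n s * f s ∂ν) cofinite (𝓝 0) := by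
  have := hν.1
  have integrable_cont : ∀ g : C(𝕋, ℂ), Integrable g ν := fun g =>
    (BoundedContinuousFunction.mkOfCompact g).integrable ν
  refine tendsto_integral_fourier_mul_of_forall_approx hf fun ε hε => ?_
  obtain ⟨g, hfg, hg⟩ := hf.exists_boundedContinuous_integral_sub_le hε
  refine ⟨g, hg, hfg, tendsto_integral_fourier_mul_of_forall_approx hg fun δ hδ => ?_⟩
  obtain ⟨p, hp, hgp⟩ :=
    exists_mem_span_fourier_integral_norm_sub_le ν g.toContinuousMap hδ
  exact ⟨p, integrable_cont p, hgp, hν.tendsto_integral_fourier_mul_of_mem_span hp⟩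

theorem of_absolutelyContinuous {ν ν' : Measure 𝕋} [IsFiniteMeasure ν'] (hν : IsMixingMeasure ν)
    (h : ν' ≪ ν) : IsMixingMeasure ν' := by
  have := hν.1
  have := Measure.haveLebesgueDecomposition_of_sigmaFinite ν' ν
  refine ⟨inferInstance, ?_⟩
  have hdensity : Integrable (fun s => ((ν'.rnDeriv ν s).toReal : ℂ)) ν :=
    Measure.integrable_toReal_rnDeriv.ofReal
  refine (hν.tendsto_integral_fourier_mul hdensity).congr fun n => ?_
  have hcoeff := integral_rnDeriv_smul h (f := fun s : 𝕋 => (fourier n s : ℂ))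
  simpa only [Complex.real_smul, mul_comm] using hcoeff

theorem map_sub_left {ν : Measure 𝕋} (hν : IsMixingMeasure ν) (t : 𝕋) :
    IsMixingMeasure (ν.map (t - ·)) := by
  have := hν.1
  refine ⟨inferInstance, ?_⟩
  have h := hν.2.comp (neg_injective (G := ℤ)).tendsto_cofinite
  rw [tendsto_zero_iff_norm_tendsto_zero] at h ⊢
  refine h.congr fun n => ?_
  rw [integral_map (by fun_prop) (by fun_prop)]
  simp_rw [fourier_sub_apply]
  rw [integral_const_mul, norm_mul, norm_fourier_apply, one_mul]
  rfl

theorem smul {ν : Measure 𝕋} (hν : IsMixingMeasure ν) (c : NNReal) :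
    IsMixingMeasure (c • ν) := by
  have := hν.1
  exact hν.of_absolutelyContinuous Measure.smul_absolutelyContinuous

theorem sum {ι : Type*} {ν : ι → Measure 𝕋} (hν : ∀ i, IsMixingMeasure (ν i))
    (hfin : ∑' i, ν i Set.univ ≠ ∞) : IsMixingMeasure (Measure.sum ν) := by
  have := fun i => (hν i).1
  have : IsFiniteMeasure (Measure.sum ν) :=
    ⟨by rw [Measure.sum_apply _ .univ]; exact hfin.lt_top⟩
  refine ⟨inferInstance, ?_⟩
  have hint : ∀ n : ℤ, Integrable (fun s : 𝕋 => (fourier n s : ℂ)) (Measure.sum ν) := fun n =>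
    (BoundedContinuousFunction.mkOfCompact (fourier n)).integrable _
  have hbound : ∀ n i, ‖∫ s, (fourier n s : ℂ) ∂ν i‖ ≤ (ν i).real Set.univ := fun n i => by
    simpa only [one_mul] using
      norm_integral_le_of_norm_le_const (ae_of_all (ν i) fun s => (norm_fourier_apply n s).le)
  have h := tendsto_tsum_of_dominated_convergence (ENNReal.summable_toReal hfin)
    (fun i => (hν i).2) (Eventually.of_forall fun n i => hbound n i)
  rw [tsum_zero] at h
  exact h.congr fun n => (integral_sum_measure (hint n)).symm

end IsMixingMeasure

theorem exists_isMixingMeasure_forall_absolutelyContinuous {ι : Type*} [Countable ι]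
    {ν : ι → Measure 𝕋} (hν : ∀ i, IsMixingMeasure (ν i)) :
    ∃ ν', IsMixingMeasure ν' ∧ ∀ i, ν i ≪ ν' := by
  have := fun i => (hν i).1
  obtain ⟨c, hc, hsum⟩ := ENNReal.exists_pos_tsum_mul_lt_of_countable one_ne_zero
    (fun i => ν i Set.univ) fun i => measure_ne_top _ _
  have hfin : ∑' i, (c i • ν i) Set.univ ≠ ∞ := by
    refine ne_top_of_lt (b := 1) (lt_of_eq_of_lt (tsum_congr fun i => ?_) hsum)
    rw [mul_comm]; rfl
  refine ⟨_, IsMixingMeasure.sum (fun i => (hν i).smul (c i)) hfin, fun i => ?_⟩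
  exact (Measure.absolutelyContinuous_smul (ENNReal.coe_pos.2 (hc i)).ne').trans
    (Measure.absolutelyContinuous_sum_right i .rfl)

end MixingMeasures

section Disintegration

variable {X Y : Type*} [MeasurableSpace X] [MeasurableSpace Y]

theorem ae_eq_of_forall_ae_apply_eq [MeasurableSpace.CountablyGenerated X] {μ : Measure Y}
    {κ κ' : Y → Measure X} (hfin : ∀ᵐ y ∂μ, IsFiniteMeasure (κ y))
    (h : ∀ B, MeasurableSet B → ∀ᵐ y ∂μ, κ y B = κ' y B) : κ =ᵐ[μ] κ' := by
  obtain ⟨b, hb_countable, hb⟩ : ∃ b : Set (Set X), b.Countable ∧ ‹MeasurableSpace X› =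
      .generateFrom b := MeasurableSpace.CountablyGenerated.isCountablyGenerated
  have hgen : ‹MeasurableSpace X› = .generateFrom (generateSetAlgebra b) := by
    rw [generateFrom_generateSetAlgebra_eq]; exact hb
  have hpi : IsPiSystem (generateSetAlgebra b) :=
    isSetAlgebra_generateSetAlgebra.isSetRing.isSetSemiring.isPiSystem
  have halgebra : ∀ᵐ y ∂μ, ∀ B ∈ generateSetAlgebra b, κ y B = κ' y B :=
    (ae_ball_iff (countable_generateSetAlgebra hb_countable)).2 fun B hB =>
      h B (by rw [hgen]; exact MeasurableSpace.measurableSet_generateFrom hB)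
  filter_upwards [hfin, halgebra, h _ .univ] with y hy hy_algebra hy_univ
  exact ext_of_generate_finite _ hgen hpi hy_algebra hy_univ

namespace IsDisintegration

variable {β : Measure X} {T : X → Y} {μ : Measure Y} {κ κ' : Y → Measure X}

theorem measurable_apply (hκ : IsDisintegration β T μ κ) {B : Set X} (hB : MeasurableSet B) :
    Measurable fun y => κ y B := by
  simpa only [lintegral_indicator_one hB] using
    hκ.measurable (B.indicator 1) (measurable_one.indicator hB)

theorem setLIntegral_apply (hκ : IsDisintegration β T μ κ) (hT : Measurable T) {A : Set Y}
    (hA : MeasurableSet A) {B : Set X} (hB : MeasurableSet B) :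
    ∫⁻ y in A, κ y B ∂μ = β (T ⁻¹' A ∩ B) := by
  have hAB : MeasurableSet (T ⁻¹' A ∩ B) := (hT hA).inter hB
  rw [← lintegral_indicator_one hAB, hκ.lintegral_eq _ (measurable_one.indicator hAB),
    ← lintegral_indicator hA]
  refine lintegral_congr_ae ?_
  filter_upwards [hκ.concentrated] with y hy
  have hfiber : ∀ᵐ x ∂κ y, T x = y := hy
  rw [lintegral_indicator_one hAB]
  by_cases hyA : y ∈ A
  · rw [Set.indicator_of_mem hyA]
    refine measure_congr ?_
    filter_upwards [hfiber] with x hx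
    exact propext ⟨fun hxB => ⟨by rwa [Set.mem_preimage, hx], hxB⟩, fun hxB => hxB.2⟩
  · rw [Set.indicator_of_notMem hyA]
    refine (measure_mono_null (fun x hx => ?_) hy).symm
    rintro rfl
    exact hyA hx.1

theorem ae_isFiniteMeasure [IsFiniteMeasure β] (hκ : IsDisintegration β T μ κ) :
    ∀ᵐ y ∂μ, IsFiniteMeasure (κ y) := by
  have hmass : ∫⁻ y, κ y Set.univ ∂μ = β Set.univ := by
    simpa only [Pi.one_apply, lintegral_one] using (hκ.lintegral_eq 1 measurable_one).symm
  filter_upwards [ae_lt_top (hκ.measurable_apply .univ) (hmass ▸ measure_ne_top β _)] with y hy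
  exact ⟨hy⟩

theorem ae_eq [MeasurableSpace.CountablyGenerated X] [IsFiniteMeasure β] [SigmaFinite μ]
    (hκ : IsDisintegration β T μ κ) (hκ' : IsDisintegration β T μ κ') (hT : Measurable T) :
    κ =ᵐ[μ] κ' :=
  ae_eq_of_forall_ae_apply_eq hκ.ae_isFiniteMeasure fun _ hB =>
    ae_eq_of_forall_setLIntegral_eq_of_sigmaFinite (hκ.measurable_apply hB)
      (hκ'.measurable_apply hB) fun _ hA _ => by
        rw [hκ.setLIntegral_apply hT hA hB, hκ'.setLIntegral_apply hT hA hB]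

theorem withDensity (hκ : IsDisintegration β T μ κ) {g : X → NNReal} (hg : Measurable g) :
    IsDisintegration (β.withDensity fun x => (g x : ℝ≥0∞)) T μ
      (fun y => (κ y).withDensity fun x => (g x : ℝ≥0∞)) := by
  have hg' : Measurable fun x => (g x : ℝ≥0∞) := hg.coe_nnreal_ennreal
  refine ⟨fun y => ?_, ?_, fun f hf => ?_, fun f hf => ?_⟩
  · have := hκ.sigmaFinite y
    exact SigmaFinite.withDensity g
  · filter_upwards [hκ.concentrated] with y hy
    exact withDensity_absolutelyContinuous _ _ hy
  · simp_rw [lintegral_withDensity_eq_lintegral_mul _ hg' hf]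
    exact hκ.measurable _ (hg'.mul hf)
  · simp_rw [lintegral_withDensity_eq_lintegral_mul _ hg' hf]
    exact hκ.lintegral_eq _ (hg'.mul hf)

theorem exists_absolutelyContinuous [SigmaFinite β] (hκ : IsDisintegration β T μ κ)
    {η : Measure X} [SigmaFinite η] (hη : η ≪ β) :
    ∃ κ', IsDisintegration η T μ κ' ∧ ∀ y, κ' y ≪ κ y := by
  have hdensity : β.withDensity (fun x => ((η.rnDeriv β x).toNNReal : ℝ≥0∞)) = η := by
    conv_rhs => rw [← Measure.withDensity_rnDeriv_eq η β hη]
    refine withDensity_congr_ae ?_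
    filter_upwards [Measure.rnDeriv_lt_top η β] with x hx
    exact ENNReal.coe_toNNReal hx.ne
  have hdis := hκ.withDensity (Measure.measurable_rnDeriv η β).ennreal_toNNReal
  rw [hdensity] at hdis
  exact ⟨_, hdis, fun y => withDensity_absolutelyContinuous _ _⟩

end IsDisintegration

theorem isDisintegration_map_prod [MeasurableSingletonClass Y] {R : Type*} [MeasurableSpace R]
    (μ : Measure Y) (ν : Measure R) [IsFiniteMeasure ν] {T : X → Y} (hT : Measurable T)
    {Φ : Y × R → X} (hΦ : Measurable Φ) (hTΦ : ∀ p, T (Φ p) = p.1) :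
    IsDisintegration ((μ.prod ν).map Φ) T μ (fun y => ν.map fun r => Φ (y, r)) := by
  have hΦy : ∀ y, Measurable fun r => Φ (y, r) := fun y => hΦ.comp measurable_prodMk_left
  refine ⟨fun y => inferInstance, ae_of_all _ fun y => ?_, fun f hf => ?_, fun f hf => ?_⟩
  · have hmeas : MeasurableSet {x | T x ≠ y} := (hT (measurableSet_singleton y)).compl
    simp [Measure.map_apply (hΦy y) hmeas, hTΦ]
  · simp_rw [lintegral_map hf (hΦy _)]
    exact (hf.comp hΦ).lintegral_prod_right'
  · simp_rw [lintegral_map hf hΦ, lintegral_map hf (hΦy _)]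
    exact lintegral_prod _ (hf.comp hΦ).aemeasurable

end Disintegration

section Fibres

variable {X R : Type*} [MeasurableSpace X] [MeasurableSingletonClass X] [MeasurableSpace R]

theorem fiberMeasure_absolutelyContinuous {ν ν' : Measure (X × X)} (h : ν ≪ ν') (t : X) :
    fiberMeasure ν t ≪ fiberMeasure ν' t := by
  intro B hB
  have hemb := measurableEmbedding_prodMk_left (β := X) t
  rw [fiberMeasure, hemb.comap_apply] at hB ⊢
  exact h hB

theorem fiberMeasure_map_prodMk (ν : Measure R) (t : X) {f : R → X} (hf : Measurable f) :
    fiberMeasure (ν.map fun r => (t, f r)) t = ν.map f := by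
  have hcomp : (ν.map f).map (Prod.mk t) = ν.map fun r => (t, f r) :=
    Measure.map_map measurable_prodMk_left hf
  rw [fiberMeasure, ← hcomp, (measurableEmbedding_prodMk_left t).comap_map]

end Fibres

section Shear

local notation "𝕋" => UnitAddCircle
local notation "haar" => (AddCircle.haarAddCircle : Measure UnitAddCircle)

/-- The image of `λ × ν` under `(t, r) ↦ (t, t - r)`: the measure on the torus whose fibre over `t`
is the translate by `t` of the reflection of `ν`. -/
def haarShear (ν : Measure 𝕋) : Measure (𝕋 × 𝕋) :=
  ((haar).prod ν).map fun p => (p.1, p.1 - p.2)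

instance (ν : Measure 𝕋) [IsFiniteMeasure ν] : IsFiniteMeasure (haarShear ν) := by
  unfold haarShear; infer_instance

theorem haarShear_absolutelyContinuous {ν ν' : Measure 𝕋} [SFinite ν'] (h : ν ≪ ν') :
    haarShear ν ≪ haarShear ν' :=
  (Measure.AbsolutelyContinuous.rfl.prod h).map (by fun_prop)

theorem isDisintegration_haarShear (ν : Measure 𝕋) [IsFiniteMeasure ν] :
    IsDisintegration (haarShear ν) Prod.fst haar fun t => ν.map fun r => (t, t - r) :=
  isDisintegration_map_prod haar ν measurable_fst (by fun_prop) fun _ => rfl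

theorem integral_fourier_mul_fourier_haarShear (ν : Measure 𝕋) [IsFiniteMeasure ν] (m n : ℤ) :
    ∫ z, (fourier m z.1 : ℂ) * fourier n z.2 ∂haarShear ν =
      if m + n = 0 then ∫ r, (fourier (-n) r : ℂ) ∂ν else 0 := by
  rw [haarShear, integral_map (by fun_prop) (by fun_prop)]
  simp_rw [fourier_sub_apply, ← mul_assoc, ← fourier_add]
  rw [integral_prod_mul (μ := haar) (ν := ν) (fun t => (fourier (m + n) t : ℂ))
    fun r => (fourier (-n) r : ℂ), integral_fourier_haarAddCircle, ite_mul, one_mul, zero_mul]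

theorem eq_haarShear_of_integral_eq_zero {σ : Measure (𝕋 × 𝕋)} [IsFiniteMeasure σ]
    (hσ : ∀ m n : ℤ, m + n ≠ 0 → ∫ z, (fourier m z.1 : ℂ) * fourier n z.2 ∂σ = 0) :
    σ = haarShear (σ.map fun z => z.1 - z.2) := by
  refine ext_of_integral_fourier_mul_fourier fun m n => ?_
  rw [integral_fourier_mul_fourier_haarShear]
  split_ifs with hmn
  · rw [integral_map (by fun_prop) (by fun_prop), eq_neg_of_add_eq_zero_left hmn]
    simp_rw [fourier_sub_apply, neg_neg]
  · exact hσ m n hmn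

theorem exists_disintegration_and_ae_isMixingMeasure {η : Measure (𝕋 × 𝕋)} [IsFiniteMeasure η]
    {ν : Measure 𝕋} (hν : IsMixingMeasure ν) (hη : η ≪ haarShear ν) :
    (∃ κ : 𝕋 → Measure (𝕋 × 𝕋), IsDisintegration η Prod.fst haar κ) ∧
    ∀ κ : 𝕋 → Measure (𝕋 × 𝕋), IsDisintegration η Prod.fst haar κ →
      ∀ᵐ t ∂haar, IsMixingMeasure (fiberMeasure (κ t) t) := by
  have := hν.1
  obtain ⟨κ₀, hκ₀, hac⟩ := (isDisintegration_haarShear ν).exists_absolutelyContinuous hη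
  refine ⟨⟨κ₀, hκ₀⟩, fun κ hκ => ?_⟩
  filter_upwards [hκ.ae_eq hκ₀ measurable_fst, hκ.ae_isFiniteMeasure] with t ht hfin
  have hfiber : fiberMeasure (κ t) t ≪ ν.map (t - ·) := by
    rw [ht, ← fiberMeasure_map_prodMk ν t (measurable_const_sub t)]
    exact fiberMeasure_absolutelyContinuous (hac t) t
  have : IsFiniteMeasure (fiberMeasure (κ t) t) := by unfold fiberMeasure; infer_instance
  exact (hν.map_sub_left t).of_absolutelyContinuous hfiber

end Shear

section DirectIntegral

variable {Z : Type*} [MeasurableSpace Z] {F : MeasurableHilbertField Z} {ρ : Measure Z}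
  {K : Type*} [NormedAddCommGroup K] [InnerProductSpace ℂ K]

namespace DirectIntegralIso

variable (U : DirectIntegralIso F ρ K)

theorem map_sub (ζ ζ' : K) :
    ∀ᵐ z ∂ρ, U.toSection (ζ - ζ') z = U.toSection ζ z - U.toSection ζ' z := by
  filter_upwards [U.map_add (ζ - ζ') ζ'] with z hz
  rw [sub_add_cancel] at hz
  rw [hz, add_sub_cancel_right]

theorem inner_eq_integral (ζ ζ' : K) :
    ⟪ζ, ζ'⟫_ℂ = ∫ z, ⟪U.toSection ζ z, U.toSection ζ' z⟫_ℂ ∂ρ := by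
  have integrable_sq : ∀ ζ : K, Integrable (fun z => (‖U.toSection ζ z‖ : ℂ) ^ 2) ρ := fun ζ => by
    simpa using (U.isL2Section ζ).integrable.ofReal (𝕜 := ℂ)
  have norm_sq : ∀ ζ : K, (‖ζ‖ : ℂ) ^ 2 = ∫ z, (‖U.toSection ζ z‖ : ℂ) ^ 2 ∂ρ := fun ζ => by
    rw [← Complex.ofReal_pow, U.norm_sq, ← integral_complex_ofReal]
    simp
  have integrable_sub : ∀ ζ₁ ζ₂ : K, Integrable
      (fun z => (‖U.toSection ζ₁ z‖ : ℂ) ^ 2 - (‖U.toSection ζ₂ z‖ : ℂ) ^ 2) ρ :=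
    fun ζ₁ ζ₂ => (integrable_sq ζ₁).sub (integrable_sq ζ₂)
  rw [inner_eq_sum_norm_sq_div_four]
  simp only [Complex.coe_algebraMap, RCLike.I_to_complex]
  rw [norm_sq, norm_sq, norm_sq, norm_sq, ← integral_sub (integrable_sq _) (integrable_sq _),
    ← integral_sub (integrable_sq _) (integrable_sq _), ← integral_mul_const,
    ← integral_add (integrable_sub _ _) ((integrable_sub _ _).mul_const _), ← integral_div]
  refine integral_congr_ae ?_
  filter_upwards [U.map_add ζ ζ', U.map_sub ζ ζ', U.map_add ζ (Complex.I • ζ'),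
    U.map_sub ζ (Complex.I • ζ'), U.map_smul Complex.I ζ'] with z hadd hsub haddI hsubI hI
  rw [inner_eq_sum_norm_sq_div_four, hadd, hsub, haddI, hsubI, hI]
  simp

/-- The vectors which are represented by sections vanishing almost everywhere on a given set. -/
def vanishingOn (E : Set Z) : Submodule ℂ K where
  carrier := {ζ | ∀ᵐ z ∂ρ, z ∈ E → U.toSection ζ z = 0}
  add_mem' {ζ ζ'} h h' := by
    filter_upwards [h, h', U.map_add ζ ζ'] with z hz hz' hadd hE
    rw [hadd, hz hE, hz' hE, add_zero]
  zero_mem' := by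
    filter_upwards [U.map_smul 0 0] with z hz _
    simpa using hz
  smul_mem' c ζ h := by
    filter_upwards [h, U.map_smul c ζ] with z hz hsmul hE
    rw [hsmul, hz hE, smul_zero]

variable {U} in
theorem mem_vanishingOn {E : Set Z} {ζ : K} :
    ζ ∈ U.vanishingOn E ↔ ∀ᵐ z ∂ρ, z ∈ E → U.toSection ζ z = 0 := Iff.rfl

theorem vanishingOn_anti {E E' : Set Z} (h : E ⊆ E') : U.vanishingOn E' ≤ U.vanishingOn E :=
  fun _ hζ => (mem_vanishingOn.1 hζ).mono fun _ hz hzE => hz (h hzE)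

/-- The spectral measure of the vector `ζ` for the diagonalizable operators, that is, the measure
representing `f ↦ ⟪ζ, f ζ⟫`. -/
def spectralMeasure (ζ : K) : Measure Z :=
  ρ.withDensity fun z => ENNReal.ofReal (‖U.toSection ζ z‖ ^ 2)

theorem aemeasurable_norm_sq (ζ : K) :
    AEMeasurable (fun z => ENNReal.ofReal (‖U.toSection ζ z‖ ^ 2)) ρ :=
  (U.isL2Section ζ).integrable.aestronglyMeasurable.aemeasurable.ennreal_ofReal

theorem spectralMeasure_apply_le (ζ : K) (E : Set Z) :
    U.spectralMeasure ζ E ≤ ENNReal.ofReal (‖ζ‖ ^ 2) := by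
  refine (measure_mono E.subset_univ).trans_eq ?_
  rw [spectralMeasure, withDensity_apply _ .univ, setLIntegral_univ, U.norm_sq,
    ofReal_integral_eq_lintegral_ofReal (U.isL2Section ζ).integrable
      (ae_of_all _ fun z => sq_nonneg _)]

instance (ζ : K) : IsFiniteMeasure (U.spectralMeasure ζ) :=
  ⟨(U.spectralMeasure_apply_le ζ _).trans_lt ENNReal.ofReal_lt_top⟩

theorem integral_spectralMeasure {f : Z → ℂ} {ζ ζ' : K}
    (h : ∀ᵐ z ∂ρ, U.toSection ζ' z = f z • U.toSection ζ z) :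
    ∫ z, f z ∂U.spectralMeasure ζ = ⟪ζ, ζ'⟫_ℂ := by
  rw [spectralMeasure, integral_withDensity_eq_integral_toReal_smul₀ (U.aemeasurable_norm_sq ζ)
    (ae_of_all _ fun _ => ENNReal.ofReal_lt_top), U.inner_eq_integral]
  refine integral_congr_ae ?_
  filter_upwards [h] with z hz
  rw [hz, inner_smul_right, inner_self_eq_norm_sq_to_K, ENNReal.toReal_ofReal (sq_nonneg _),
    Complex.real_smul, mul_comm]
  simp

theorem mem_vanishingOn_iff_spectralMeasure {E : Set Z} {ζ : K} :
    ζ ∈ U.vanishingOn E ↔ U.spectralMeasure ζ E = 0 := by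
  rw [spectralMeasure, withDensity_apply_eq_zero' (U.aemeasurable_norm_sq ζ), mem_vanishingOn,
    ae_iff]
  refine iff_of_eq (congrArg (ρ · = 0) (Set.ext fun z => ?_))
  simp [and_comm]

theorem spectralMeasure_apply_eq_of_sub_mem {E : Set Z} (hE : MeasurableSet E) {ζ ζ' : K}
    (h : ζ - ζ' ∈ U.vanishingOn E) : U.spectralMeasure ζ E = U.spectralMeasure ζ' E := by
  rw [spectralMeasure, spectralMeasure, withDensity_apply _ hE, withDensity_apply _ hE]
  refine setLIntegral_congr_fun_ae hE ?_
  filter_upwards [mem_vanishingOn.1 h, U.map_sub ζ ζ'] with z hz hsub hzE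
  rw [sub_eq_zero.1 (hsub.symm.trans (hz hzE))]

theorem isClosed_vanishingOn {E : Set Z} (hE : MeasurableSet E) :
    IsClosed (U.vanishingOn E : Set K) := by
  refine isClosed_of_closure_subset fun ζ hζ => ?_
  obtain ⟨s, hs, hlim⟩ := mem_closure_iff_seq_limit.1 hζ
  have hle : ∀ k, U.spectralMeasure ζ E ≤ ENNReal.ofReal (‖ζ - s k‖ ^ 2) := fun k => by
    rw [U.spectralMeasure_apply_eq_of_sub_mem hE (ζ' := ζ - s k) (by simpa using hs k)]
    exact U.spectralMeasure_apply_le _ E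
  have hzero : Tendsto (fun k => ENNReal.ofReal (‖ζ - s k‖ ^ 2)) atTop (𝓝 0) := by
    simpa using ENNReal.tendsto_ofReal (((tendsto_const_nhds (x := ζ)).sub hlim).norm.pow 2)
  exact U.mem_vanishingOn_iff_spectralMeasure.2
    (le_antisymm (ge_of_tendsto' hzero hle) zero_le)

end DirectIntegralIso

namespace MeasurableHilbertField

theorem exists_fund_ne_zero (F : MeasurableHilbertField Z) (z : Z) [Nontrivial (F.fiber z)] :
    ∃ i, F.fund i z ≠ 0 := by
  by_contra! h
  have hspan : Submodule.span ℂ (Set.range fun i => F.fund i z) = ⊥ := by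
    rw [Submodule.span_eq_bot]
    rintro _ ⟨i, rfl⟩
    exact h i
  have hclosed : IsClosed ((⊥ : Submodule ℂ (F.fiber z)) : Set (F.fiber z)) :=
    Submodule.closed_of_finiteDimensional _
  have htotal := F.total z
  rw [hspan, hclosed.submodule_topologicalClosure_eq] at htotal
  exact bot_ne_top htotal

theorem measurable_norm_fund (F : MeasurableHilbertField Z) (i : ℕ) :
    Measurable fun z => ‖F.fund i z‖ := by
  simp_rw [norm_eq_sqrt_re_inner (𝕜 := ℂ)]
  exact (Complex.measurable_re.comp (F.measurable_inner i i)).sqrt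

theorem isL2Section_bounded_fund (F : MeasurableHilbertField Z) (ρ : Measure Z) [IsFiniteMeasure ρ]
    (i : ℕ) : F.IsL2Section ρ fun z => ((1 + ‖F.fund i z‖ : ℝ) : ℂ)⁻¹ • F.fund i z := by
  have hmeas := F.measurable_norm_fund i
  refine ⟨fun j => ?_, ?_⟩
  · simp_rw [inner_smul_right]
    exact ((Complex.measurable_ofReal.comp (hmeas.const_add 1)).inv.mul
      (F.measurable_inner j i)).aemeasurable
  · have hnorm : ∀ z, ‖((1 + ‖F.fund i z‖ : ℝ) : ℂ)⁻¹ • F.fund i z‖ =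
        (1 + ‖F.fund i z‖)⁻¹ * ‖F.fund i z‖ := fun z => by
      rw [norm_smul, norm_inv, Complex.norm_real, Real.norm_of_nonneg (by positivity)]
    simp_rw [hnorm]
    refine Integrable.of_bound (C := 1) (by fun_prop) (ae_of_all _ fun z => ?_)
    have hle : (1 + ‖F.fund i z‖)⁻¹ * ‖F.fund i z‖ ≤ 1 := by
      rw [inv_mul_le_iff₀ (by positivity)]; linarith
    rw [Real.norm_of_nonneg (by positivity)]
    exact pow_le_one₀ (by positivity) hle

end MeasurableHilbertField

theorem DirectIntegralIso.exists_seq_null_of_mem_vanishingOn [IsFiniteMeasure ρ]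
    (U : DirectIntegralIso F ρ K) (hF : ∀ᵐ z ∂ρ, Nontrivial (F.fiber z)) :
    ∃ ζ : ℕ → K, ∀ E : Set Z, (∀ i, ζ i ∈ U.vanishingOn E) → ρ E = 0 := by
  choose ζ hζ using fun i => U.surjective _ (F.isL2Section_bounded_fund ρ i)
  refine ⟨ζ, fun E hE => measure_eq_zero_iff_ae_notMem.2 ?_⟩
  filter_upwards [hF, ae_all_iff.2 hζ, ae_all_iff.2 fun i => mem_vanishingOn.1 (hE i)]
    with z hnontrivial hsection hvanish hz
  obtain ⟨i, hi⟩ := F.exists_fund_ne_zero z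
  have hscalar : ((1 + ‖F.fund i z‖ : ℝ) : ℂ)⁻¹ ≠ 0 :=
    inv_ne_zero (Complex.ofReal_ne_zero.2 (by positivity))
  exact smul_ne_zero hscalar hi ((hsection i).symm.trans (hvanish i hz))

theorem exists_countable_mem_closure_span {𝕜 ι E : Type*} [Semiring 𝕜] [AddCommMonoid E]
    [Module 𝕜 E] [TopologicalSpace E] [FrechetUrysohnSpace E] {g : ι → E} {x : E}
    (hx : x ∈ closure (Submodule.span 𝕜 (Set.range g) : Set E)) :
    ∃ C : Set ι, C.Countable ∧ x ∈ closure (Submodule.span 𝕜 (g '' C) : Set E) := by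
  obtain ⟨s, hs, hlim⟩ := mem_closure_iff_seq_limit.1 hx
  choose c hc using fun k => Finsupp.mem_span_range_iff_exists_finsupp.1 (hs k)
  refine ⟨⋃ k, (c k).support, Set.countable_iUnion fun k => (c k).support.countable_toSet,
    mem_closure_of_tendsto hlim (Eventually.of_forall fun k => ?_)⟩
  rw [← hc k]
  exact Submodule.sum_mem _ fun i hi => Submodule.smul_mem _ _
    (Submodule.subset_span ⟨i, Set.mem_iUnion.2 ⟨k, hi⟩, rfl⟩)

theorem DirectIntegralIso.exists_countable_null_of_mem_vanishingOn [IsFiniteMeasure ρ]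
    (U : DirectIntegralIso F ρ K) (hF : ∀ᵐ z ∂ρ, Nontrivial (F.fiber z)) {ι : Type*} {g : ι → K}
    (hg : Dense (Submodule.span ℂ (Set.range g) : Set K)) :
    ∃ C : Set ι, C.Countable ∧
      ∀ E, MeasurableSet E → (∀ i ∈ C, g i ∈ U.vanishingOn E) → ρ E = 0 := by
  obtain ⟨ζ, hζ⟩ := U.exists_seq_null_of_mem_vanishingOn hF
  choose C hC hmem using fun n => exists_countable_mem_closure_span (hg (ζ n))
  refine ⟨⋃ n, C n, Set.countable_iUnion hC, fun E hE hvanish => hζ E fun n => ?_⟩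
  refine closure_minimal ?_ (U.isClosed_vanishingOn hE) (hmem n)
  refine Submodule.span_le.2 ?_
  rintro _ ⟨i, hi, rfl⟩
  exact hvanish i (Set.mem_iUnion.2 ⟨n, hi⟩)

end DirectIntegral

section Bimodule

variable {K : Type*} [NormedAddCommGroup K] [InnerProductSpace ℂ K] [CompleteSpace K]
  {M : VonNeumannAlgebra K} {φ : PositiveFunctional M}

namespace PositiveFunctional

variable (φ)

/-- The canonical map `M → L²(M, φ)` as a linear map. -/
def toL2Lin : Elem M →ₗ[ℂ] φ.L2 where
  toFun := φ.toL2
  map_add' _ _ := UniformSpace.Completion.coe_add _ _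
  map_smul' c x := UniformSpace.Completion.coe_smul c (φ.toPreL2 x)

theorem toL2Lin_apply (x : Elem M) : φ.toL2Lin x = φ.toL2 x := rfl

theorem denseRange_toL2 : DenseRange φ.toL2 :=
  UniformSpace.Completion.denseRange_coe (α := φ.PreL2)

theorem norm_toL2_sq (x : Elem M) : ((‖φ.toL2 x‖ ^ 2 : ℝ) : ℂ) = φ (star x * x) := by
  rw [← φ.inner_toL2, inner_self_eq_norm_sq_to_K, Complex.ofReal_pow]
  rfl

end PositiveFunctional

variable {F : MeasurableHilbertField (UnitAddCircle × UnitAddCircle)}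
  {ρ : Measure (UnitAddCircle × UnitAddCircle)} {U : DirectIntegralIso F ρ φ.L2}
  {v : unitary (Elem M)}

/-- The identification `U` of `L²(M, φ)` with a direct integral over the torus turns
`ζ ↦ vᵐ ζ vⁿ` into multiplication by `(t, s) ↦ tᵐ sⁿ`, as in `IsLeftRightMeasure`. -/
def IsBimodular (v : unitary (Elem M)) (U : DirectIntegralIso F ρ φ.L2) : Prop :=
  ∀ (m n : ℤ) (y : Elem M), ∀ᵐ z ∂ρ,
    U.toSection (φ.toL2 (↑(v ^ m) * y * ↑(v ^ n))) z =
      ((fourier m z.1 : ℂ) * (fourier n z.2 : ℂ)) • U.toSection (φ.toL2 y) z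

namespace IsBimodular

theorem integral_spectralMeasure (hU : IsBimodular v U) (y : Elem M) (m n : ℤ) :
    ∫ z, (fourier m z.1 : ℂ) * fourier n z.2 ∂U.spectralMeasure (φ.toL2 y) =
      φ (star y * (↑(v ^ m) * y * ↑(v ^ n))) := by
  rw [U.integral_spectralMeasure (hU m n y), φ.inner_toL2]

theorem toL2_one_mem_vanishingOn (hU : IsBimodular v U) :
    φ.toL2 1 ∈ U.vanishingOn (Set.diagonal UnitAddCircle)ᶜ := by
  have hconj : (↑(v ^ (1 : ℤ)) * 1 * ↑(v ^ (-1 : ℤ)) : Elem M) = 1 := by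
    rw [mul_one, ← Submonoid.coe_mul, ← zpow_add, add_neg_cancel, zpow_zero, OneMemClass.coe_one]
  have hfix := hU 1 (-1) 1
  rw [hconj] at hfix
  rw [DirectIntegralIso.mem_vanishingOn]
  filter_upwards [hfix] with z hz hdiag
  rw [← fourier_sub_apply] at hz
  by_contra hne
  have hone : (fourier 1 (z.1 - z.2) : ℂ) = 1 :=
    smul_left_injective ℂ hne (hz.symm.trans (one_smul ℂ _).symm)
  exact hdiag (sub_eq_zero.1 (fourier_one_injective (hone.trans (fourier_eval_zero 1).symm)))

theorem toL2_zpow_mul_mem_vanishingOn (hU : IsBimodular v U)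
    {E : Set (UnitAddCircle × UnitAddCircle)} {y : Elem M} (hy : φ.toL2 y ∈ U.vanishingOn E)
    (m : ℤ) : φ.toL2 (↑(v ^ m) * y) ∈ U.vanishingOn E := by
  have hleft := hU m 0 y
  rw [zpow_zero, OneMemClass.coe_one, mul_one] at hleft
  rw [DirectIntegralIso.mem_vanishingOn] at hy ⊢
  filter_upwards [hleft, hy] with z hz hzero hzE
  rw [hz, hzero hzE, smul_zero]

end IsBimodular

end Bimodule

section Normal

variable {H : Type*} [NormedAddCommGroup H] [InnerProductSpace ℂ H] [CompleteSpace H]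
  {M : VonNeumannAlgebra H} {φ : PositiveFunctional M}

/-- Normality of a positive functional, as ultraweak continuity; the vectors `ξₙ` and `ηₙ` are as in
`PositiveFunctional.IsFaithfulNormalTracialState`. -/
def PositiveFunctional.IsNormal (φ : PositiveFunctional M) : Prop :=
  ∃ ξ η : ℕ → H, (Summable fun n => ‖ξ n‖ ^ 2) ∧ (Summable fun n => ‖η n‖ ^ 2) ∧
    ∀ x : Elem M, HasSum (fun n => ⟪η n, (x : H →L[ℂ] H) (ξ n)⟫_ℂ) (φ x)

theorem PositiveFunctional.IsNormal.tendsto_zero (hφ : φ.IsNormal) {ι L : Type*} {l : Filter ι}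
    [NormedAddCommGroup L] [InnerProductSpace ℂ L] [CompleteSpace L] {T : ι → H →L[ℂ] L}
    {x : ι → Elem M} (hx : ∀ i, (x i : H →L[ℂ] H) = (T i).adjoint ∘L T i)
    {C : ℝ} (hbound : ∀ i v, ‖T i v‖ ≤ C * ‖v‖) (hT : ∀ v, Tendsto (fun i => T i v) l (𝓝 0)) :
    Tendsto (fun i => φ (x i)) l (𝓝 0) := by
  obtain ⟨ξ, η, hξ, hη, hφ⟩ := hφ
  have hsum : ∀ i, φ (x i) = ∑' n, ⟪T i (η n), T i (ξ n)⟫_ℂ := fun i => by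
    rw [← (hφ (x i)).tsum_eq]
    simp_rw [hx, ContinuousLinearMap.comp_apply, ContinuousLinearMap.adjoint_inner_right]
  have hdom : ∀ i n, ‖⟪T i (η n), T i (ξ n)⟫_ℂ‖ ≤ C ^ 2 * (‖η n‖ ^ 2 + ‖ξ n‖ ^ 2) := fun i n => by
    calc ‖⟪T i (η n), T i (ξ n)⟫_ℂ‖ ≤ ‖T i (η n)‖ * ‖T i (ξ n)‖ := norm_inner_le_norm _ _
      _ ≤ (‖T i (η n)‖ ^ 2 + ‖T i (ξ n)‖ ^ 2) := by
        nlinarith [sq_nonneg (‖T i (η n)‖ - ‖T i (ξ n)‖), sq_nonneg ‖T i (η n)‖,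
          sq_nonneg ‖T i (ξ n)‖]
      _ ≤ (C * ‖η n‖) ^ 2 + (C * ‖ξ n‖) ^ 2 := by gcongr <;> exact hbound i _
      _ = C ^ 2 * (‖η n‖ ^ 2 + ‖ξ n‖ ^ 2) := by ring
  simp_rw [hsum]
  rw [← tsum_zero (α := ℂ) (β := ℕ)]
  refine tendsto_tsum_of_dominated_convergence ((hη.add hξ).mul_left (C ^ 2)) (fun n => ?_)
    (Eventually.of_forall hdom)
  simpa using (hT (η n)).inner (𝕜 := ℂ) (hT (ξ n))

end Normal

section EllTwo

variable {H : Type*} [NormedAddCommGroup H]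

theorem norm_sub_sum_single_le (f : EllTwo H) (s : Finset ℤ) :
    ‖f - ∑ k ∈ s, lp.single 2 k (f k)‖ ≤ ‖f‖ := by
  have hcompl := lp.norm_compl_sum_single (p := 2) (by norm_num) f s
  refine le_of_sq_le_sq ?_ (norm_nonneg f)
  norm_num at hcompl
  rw [hcompl]
  exact sub_le_self _ (Finset.sum_nonneg fun i _ => sq_nonneg _)

variable [InnerProductSpace ℂ H]

theorem deltaZero_apply (v : H) (n : ℤ) : deltaZero H v n = if n = 0 then v else 0 := by
  change (lp.single 2 (0 : ℤ) v : EllTwo H) n = _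
  rw [lp.single_apply, Pi.single_apply]

theorem norm_deltaZero (v : H) : ‖deltaZero H v‖ = ‖v‖ :=
  lp.norm_single (E := fun _ : ℤ => H) (by norm_num) (0 : ℤ) v

end EllTwo

section CrossedProduct

variable {H : Type*} [NormedAddCommGroup H] [InnerProductSpace ℂ H] [CompleteSpace H]
  {N : VonNeumannAlgebra H} (α : IntAction N)

theorem IntAction.at_zero : α.at 0 = 1 := map_one α

theorem coe_canonicalUnitary_zpow (m : ℤ) :
    ((↑(canonicalUnitary α ^ m) : Elem (crossedProduct α)) : EllTwo H →L[ℂ] EllTwo H) =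
      shiftOp H m := by
  induction m with
  | zero => rw [zpow_zero]; exact shiftOp_zero.symm
  | succ m ih => rw [zpow_add_one, ← shiftOp_mul, ← ih]; rfl
  | pred m ih => rw [zpow_sub_one, sub_eq_add_neg, ← shiftOp_mul, ← ih, ← star_shiftOp]; rfl

/-- The canonical embedding `π` of `N` into `N ⋊ ℤ`. -/
def piElem : Elem N →ₗ[ℂ] Elem (crossedProduct α) where
  toFun x := ⟨piRep α x, subset_vnGenerate _ (Or.inl ⟨x, rfl⟩)⟩
  map_add' x y := by
    ext ξ n
    change ((α.at (-n) (x + y) : Elem N) : H →L[ℂ] H) (ξ n) = _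
    rw [_root_.map_add]; rfl
  map_smul' c x := by
    ext ξ n
    change ((α.at (-n) (c • x) : Elem N) : H →L[ℂ] H) (ξ n) = _
    rw [_root_.map_smul]; rfl

theorem piElem_one : piElem α 1 = 1 := by
  ext ξ n
  change ((α.at (-n) 1 : Elem N) : H →L[ℂ] H) (ξ n) = _
  rw [_root_.map_one]; rfl

theorem star_piElem (x : Elem N) : star (piElem α x) = piElem α (star x) := by
  refine Subtype.ext (Eq.symm ?_)
  change piRep α (star x) = (piRep α x).adjoint
  rw [ContinuousLinearMap.eq_adjoint_iff]
  intro ξ ζ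
  rw [lp.inner_eq_tsum, lp.inner_eq_tsum]
  refine tsum_congr fun n => ?_
  rw [piRep_apply, piRep_apply, map_star]
  exact ContinuousLinearMap.adjoint_inner_left _ _ _

theorem condExpN_apply (T : Elem (crossedProduct α)) (v : H) :
    (condExpN α T : H →L[ℂ] H) v = (T : EllTwo H →L[ℂ] EllTwo H) (deltaZero H v) 0 :=
  adjoint_deltaZero _

theorem condExpN_star_mul_self (T : Elem (crossedProduct α)) :
    (condExpN α (star T * T) : H →L[ℂ] H) =
      ((T : EllTwo H →L[ℂ] EllTwo H) ∘L deltaZero H).adjoint ∘L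
        ((T : EllTwo H →L[ℂ] EllTwo H) ∘L deltaZero H) := by
  rw [ContinuousLinearMap.adjoint_comp]
  rfl

theorem condExpN_piElem_mul_zpow_mul_piElem_mul_zpow (x y : Elem N) (m n : ℤ) :
    condExpN α (piElem α x * (↑(canonicalUnitary α ^ m) * piElem α y *
      ↑(canonicalUnitary α ^ n))) = if m + n = 0 then x * α.at m y else 0 := by
  ext v
  rw [condExpN_apply]
  simp only [MulMemClass.coe_mul, coe_canonicalUnitary_zpow]
  change ((α.at (-0) x : Elem N) : H →L[ℂ] H)
    (((α.at (-(0 - m)) y : Elem N) : H →L[ℂ] H) (deltaZero H v (0 - m - n))) = _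
  have hindex : 0 - m - n = 0 ↔ m + n = 0 := by omega
  rw [deltaZero_apply, if_congr hindex rfl rfl, neg_zero, α.at_zero, zero_sub, neg_neg]
  split_ifs with hmn
  · rfl
  · rw [map_zero, map_zero]; rfl

/-- The Fourier coefficient `E_N(u⁻ᵏ y)` of `y ∈ N ⋊ ℤ`. -/
def crossedCoeff (y : Elem (crossedProduct α)) (k : ℤ) : Elem N :=
  condExpN α (↑(canonicalUnitary α ^ (-k)) * y)

theorem crossedCoeff_apply (y : Elem (crossedProduct α)) (k : ℤ) (v : H) :
    (crossedCoeff α y k : H →L[ℂ] H) v = (y : EllTwo H →L[ℂ] EllTwo H) (deltaZero H v) k := by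
  rw [crossedCoeff, condExpN_apply, MulMemClass.coe_mul, coe_canonicalUnitary_zpow,
    mul_apply_eq_comp, shiftOp_apply, zero_sub, neg_neg]

theorem zpow_mul_piElem_deltaZero (k : ℤ) (w : Elem N) (v : H) :
    ((↑(canonicalUnitary α ^ k) * piElem α w : Elem (crossedProduct α)) :
      EllTwo H →L[ℂ] EllTwo H) (deltaZero H v) = lp.single 2 k ((w : H →L[ℂ] H) v) := by
  rw [MulMemClass.coe_mul, coe_canonicalUnitary_zpow]
  ext n
  change ((α.at (-(n - k)) w : Elem N) : H →L[ℂ] H) (deltaZero H v (n - k)) = _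
  rw [deltaZero_apply, lp.single_apply, Pi.single_apply]
  obtain rfl | hnk := eq_or_ne n k
  · simp [α.at_zero]
  · simp [sub_eq_zero, hnk]

/-- The remainder `y - ∑ uᵏ π(yₖ)` of the Fourier series of `y ∈ N ⋊ ℤ`, where `k` runs over `s` and
`yₖ = E_N(u⁻ᵏ y)`. -/
def fourierRemainder (y : Elem (crossedProduct α)) (s : Finset ℤ) : Elem (crossedProduct α) :=
  y - ∑ k ∈ s, ↑(canonicalUnitary α ^ k) * piElem α (crossedCoeff α y k)

theorem fourierRemainder_deltaZero (y : Elem (crossedProduct α)) (s : Finset ℤ) (v : H) :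
    (fourierRemainder α y s : EllTwo H →L[ℂ] EllTwo H) (deltaZero H v) =
      (y : EllTwo H →L[ℂ] EllTwo H) (deltaZero H v) -
        ∑ k ∈ s, lp.single 2 k ((y : EllTwo H →L[ℂ] EllTwo H) (deltaZero H v) k) := by
  simp only [fourierRemainder, AddSubgroupClass.coe_sub, AddSubmonoidClass.coe_finsetSum,
    sub_apply, sum_apply, zpow_mul_piElem_deltaZero, crossedCoeff_apply]

variable {τ : PositiveFunctional N}

theorem tendsto_toL2_fourierRemainder (hτ : τ.IsNormal) (y : Elem (crossedProduct α)) :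
    Tendsto (fun s => (crossedTrace τ α).toL2 (fourierRemainder α y s)) atTop (𝓝 0) := by
  let Y : EllTwo H →L[ℂ] EllTwo H := y
  let R (s : Finset ℤ) : EllTwo H →L[ℂ] EllTwo H := fourierRemainder α y s
  have hR : ∀ s v, (R s ∘L deltaZero H) v =
      Y (deltaZero H v) - ∑ k ∈ s, lp.single 2 k (Y (deltaZero H v) k) :=
    fourierRemainder_deltaZero α y
  have hbound : ∀ s v, ‖(R s ∘L deltaZero H) v‖ ≤ ‖Y‖ * ‖v‖ := fun s v => by
    rw [hR, ← norm_deltaZero v]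
    exact (norm_sub_sum_single_le _ s).trans (Y.le_opNorm _)
  have hpointwise : ∀ v, Tendsto (fun s => (R s ∘L deltaZero H) v) atTop (𝓝 0) := fun v => by
    simp_rw [hR]
    rw [← sub_self (Y (deltaZero H v))]
    exact (lp.hasSum_single (by norm_num) (Y (deltaZero H v))).const_sub _
  have htrace := hτ.tendsto_zero (fun s => condExpN_star_mul_self α (fourierRemainder α y s))
    hbound hpointwise
  change Tendsto (fun s => crossedTrace τ α (star (fourierRemainder α y s) *
    fourierRemainder α y s)) atTop (𝓝 0) at htrace
  simp_rw [← PositiveFunctional.norm_toL2_sq, ← Complex.ofReal_zero] at htrace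
  have hnorm := (tendsto_ofReal_iff.1 htrace).sqrt
  simp_rw [Real.sqrt_sq (norm_nonneg _), Real.sqrt_zero] at hnorm
  exact tendsto_zero_iff_norm_tendsto_zero.2 hnorm

theorem dense_span_zpow_mul_piElem (hτ : τ.IsNormal) :
    Dense (Submodule.span ℂ (Set.range fun p : ℤ × Elem N => (crossedTrace τ α).toL2
      (↑(canonicalUnitary α ^ p.1) * piElem α p.2)) : Set (crossedTrace τ α).L2) := by
  refine dense_closure.1 ((crossedTrace τ α).denseRange_toL2.mono ?_)
  rintro _ ⟨y, rfl⟩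
  have hlim := (tendsto_toL2_fourierRemainder α hτ y).const_sub ((crossedTrace τ α).toL2 y)
  rw [sub_zero] at hlim
  refine mem_closure_of_tendsto hlim (Eventually.of_forall fun s => ?_)
  rw [fourierRemainder, ← PositiveFunctional.toL2Lin_apply, ← PositiveFunctional.toL2Lin_apply,
    _root_.map_sub, sub_sub_cancel, _root_.map_sum]
  exact Submodule.sum_mem _ fun k _ => Submodule.subset_span ⟨(k, crossedCoeff α y k), rfl⟩

end CrossedProduct

section Main

local notation "𝕋" => UnitAddCircle

variable {H : Type*} [NormedAddCommGroup H] [InnerProductSpace ℂ H] [CompleteSpace H]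
  {N : VonNeumannAlgebra H} {τ : PositiveFunctional N} {α : IntAction N}

theorem IntAction.IsMixing.apply_mul_apply_one (hmix : α.IsMixing τ) (x : Elem N) :
    τ x * τ 1 = τ x := by
  have hlim := hmix x 1
  simp_rw [_root_.map_one, mul_one] at hlim
  exact tendsto_nhds_unique hlim tendsto_const_nhds

theorem IntAction.IsMixing.apply_sub_smul_one (hmix : α.IsMixing τ) (x : Elem N) :
    τ (x - τ x • 1) = 0 := by
  rw [_root_.map_sub, _root_.map_smul, smul_eq_mul, hmix.apply_mul_apply_one, sub_self]

variable {F : MeasurableHilbertField (𝕋 × 𝕋)} {ρ : Measure (𝕋 × 𝕋)}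
  {U : DirectIntegralIso F ρ (crossedTrace τ α).L2}

namespace IsBimodular

theorem integral_spectralMeasure_piElem (hU : IsBimodular (canonicalUnitary α) U) (x : Elem N)
    (m n : ℤ) :
    ∫ z, (fourier m z.1 : ℂ) * fourier n z.2
        ∂U.spectralMeasure ((crossedTrace τ α).toL2 (piElem α x)) =
      if m + n = 0 then τ (star x * α.at m x) else 0 := by
  rw [hU.integral_spectralMeasure, star_piElem]
  change τ (condExpN α _) = _
  rw [condExpN_piElem_mul_zpow_mul_piElem_mul_zpow, apply_ite τ, _root_.map_zero]

theorem spectralMeasure_piElem_eq_haarShear (hU : IsBimodular (canonicalUnitary α) U)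
    (x : Elem N) :
    U.spectralMeasure ((crossedTrace τ α).toL2 (piElem α x)) =
      haarShear ((U.spectralMeasure ((crossedTrace τ α).toL2 (piElem α x))).map
        fun z => z.1 - z.2) :=
  eq_haarShear_of_integral_eq_zero fun m n hmn => by
    rw [hU.integral_spectralMeasure_piElem, if_neg hmn]

theorem isMixingMeasure_map_sub_spectralMeasure (hU : IsBimodular (canonicalUnitary α) U)
    (hmix : α.IsMixing τ) {x : Elem N} (hx : τ x = 0) :
    IsMixingMeasure ((U.spectralMeasure ((crossedTrace τ α).toL2 (piElem α x))).map
      fun z => z.1 - z.2) := by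
  have hlim := hmix (star x) x
  rw [hx, mul_zero] at hlim
  refine ⟨inferInstance, hlim.congr fun n => ?_⟩
  rw [integral_map (by fun_prop) (by fun_prop)]
  simp_rw [fourier_sub_apply]
  rw [hU.integral_spectralMeasure_piElem, if_pos (add_neg_cancel n)]

theorem zpow_mul_piElem_mem_vanishingOn (hU : IsBimodular (canonicalUnitary α) U)
    {E : Set (𝕋 × 𝕋)} (hE : E ⊆ (Set.diagonal 𝕋)ᶜ) {x : Elem N} {c : ℂ}
    (hx : (crossedTrace τ α).toL2 (piElem α (x - c • 1)) ∈ U.vanishingOn E) (k : ℤ) :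
    (crossedTrace τ α).toL2 (↑(canonicalUnitary α ^ k) * piElem α x) ∈ U.vanishingOn E := by
  refine hU.toL2_zpow_mul_mem_vanishingOn ?_ k
  have hone := U.vanishingOn_anti hE hU.toL2_one_mem_vanishingOn
  rw [← PositiveFunctional.toL2Lin_apply, _root_.map_sub, _root_.map_smul, piElem_one,
    _root_.map_sub, _root_.map_smul] at hx
  exact (Submodule.sub_mem_iff_left _ (Submodule.smul_mem _ c hone)).1 hx

theorem exists_isMixingMeasure_restrict_absolutelyContinuous [IsFiniteMeasure ρ]
    (hU : IsBimodular (canonicalUnitary α) U) (hF : ∀ᵐ z ∂ρ, Nontrivial (F.fiber z))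
    (hτ : τ.IsNormal) (hmix : α.IsMixing τ) :
    ∃ ν : Measure 𝕋, IsMixingMeasure ν ∧ ρ.restrict (Set.diagonal 𝕋)ᶜ ≪ haarShear ν := by
  obtain ⟨C, hC, hnull⟩ :=
    U.exists_countable_null_of_mem_vanishingOn hF (dense_span_zpow_mul_piElem α hτ)
  have := hC.to_subtype
  obtain ⟨ν, hν, hdom⟩ := exists_isMixingMeasure_forall_absolutelyContinuous fun p : C =>
    hU.isMixingMeasure_map_sub_spectralMeasure hmix (hmix.apply_sub_smul_one p.1.2)
  have := hν.1
  have hdiag : MeasurableSet (Set.diagonal 𝕋)ᶜ := isClosed_diagonal.measurableSet.compl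
  refine ⟨ν, hν, Measure.AbsolutelyContinuous.mk fun B hB hzero => ?_⟩
  rw [Measure.restrict_apply hB]
  refine hnull _ (hB.inter hdiag) fun p hp =>
    hU.zpow_mul_piElem_mem_vanishingOn (c := τ p.2) Set.inter_subset_right ?_ p.1
  rw [DirectIntegralIso.mem_vanishingOn_iff_spectralMeasure,
    hU.spectralMeasure_piElem_eq_haarShear]
  exact measure_mono_null Set.inter_subset_left
    (haarShear_absolutelyContinuous (hdom ⟨p, hp⟩) hzero)

end IsBimodular

end Main

end CrossedMixing

end

theorem theorem5p1_general {H : Type*} [NormedAddCommGroup H] [InnerProductSpace ℂ H]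
    [CompleteSpace H] (N : VonNeumannAlgebra H) (τ : PositiveFunctional N) (hτ : τ.IsNormal)
    (α : IntAction N) (hmix : α.IsMixing τ)
    (η : Measure (UnitAddCircle × UnitAddCircle))
    (hη : IsLeftRightMeasure (crossedTrace τ α) (canonicalUnitary α) η) :
    (∃ κ : UnitAddCircle → Measure (UnitAddCircle × UnitAddCircle),
      IsDisintegration η Prod.fst AddCircle.haarAddCircle κ) ∧
    ∀ κ : UnitAddCircle → Measure (UnitAddCircle × UnitAddCircle),
      IsDisintegration η Prod.fst AddCircle.haarAddCircle κ →
        ∀ᵐ t ∂(AddCircle.haarAddCircle : Measure UnitAddCircle),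
          IsMixingMeasure (fiberMeasure (κ t) t) := by
  obtain ⟨hfin, ρ, hρ, F, U, hF, hU, hac, -⟩ := hη
  obtain ⟨ν, hν, hdom⟩ :=
    IsBimodular.exists_isMixingMeasure_restrict_absolutelyContinuous (U := U) hU hF hτ hmix
  exact exists_disintegration_and_ae_isMixingMeasure hν (hac.trans hdom)

theorem theorem5p1 {H : Type*} [NormedAddCommGroup H] [InnerProductSpace ℂ H] [CompleteSpace H]
    [TopologicalSpace.SeparableSpace H]
    (N : VonNeumannAlgebra H) (hN : IsDiffuse N)
    (τ : PositiveFunctional N) (hτ : τ.IsFaithfulNormalTracialState)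
    (α : IntAction N) (hpres : α.Preserves τ) (hfree : α.IsFree) (hmix : α.IsMixing τ)
    (η : Measure (UnitAddCircle × UnitAddCircle))
    (hη : IsLeftRightMeasure (crossedTrace τ α) (canonicalUnitary α) η) :
    (∃ κ : UnitAddCircle → Measure (UnitAddCircle × UnitAddCircle),
      IsDisintegration η Prod.fst AddCircle.haarAddCircle κ) ∧
    ∀ κ : UnitAddCircle → Measure (UnitAddCircle × UnitAddCircle),
      IsDisintegration η Prod.fst AddCircle.haarAddCircle κ →
        ∀ᵐ t ∂(AddCircle.haarAddCircle : Measure UnitAddCircle),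
          IsMixingMeasure (fiberMeasure (κ t) t) :=
  theorem5p1_general N τ hτ.normal α hmix η hη
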